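/- Let $d,n\in\mathbb{N}$ with $n\ge 1$, and let $\mathrm{sinc}(\xi)=\frac{\sin(\pi\xi)}{\pi\xi}$ for $\xi\neq0$, $\mathrm{sinc}(0)=1$. For a Schwartz function $g\in\mathcal{S}(\mathbb{R}^{m})\setminus\{0\}$ and a tempered distribution $f\in\mathcal{S}'(\mathbb{R}^{m})$, let $$V_gf(x,\omega)=\int_{\mathbb{R}^{m}} f(y)\,\overline{g(y-x)}\,e^{-2\pi i y\cdot\omega}\,dy\qquad(x,\omega\in\mathbb{R}^m)$$ (in the sense of the action of $f$ on the Schwartz function $y\mapsto\overline{g(y-x)}\,e^{-2\pi i y\cdot\omega}$) be the short-time Fourier transform of $f$ with window $g$. The Wiener algebra $W(\mathcal{F}L^1,L^\infty)(\mathbb{R}^{m})$ is the space of all $f\in\mathcal{S}'(\mathbb{R}^{m})$ such that $$\operatorname*{ess\,sup}_{x\in\mathbb{R}^{m}}\int_{\mathbb{R}^{m}}|V_gf(x,\omega)|\,d\omega<\infty$$ for every window $g\in\mathcal{S}(\mathbb{R}^m)\setminus\{0\}$ (different windows give equivalent norms). Then the $n$th Born–Jordan kernel $$\Theta^n(x,\omega)=\mathrm{sinc}^n(x\cdot\omega),\qquad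 (x,\omega)\in\mathbb{R}^d\times\mathbb{R}^d=\mathbb{R}^{2d},$$ regarded as a tempered distribution, belongs to $W(\mathcal{F}L^1,L^\infty)(\mathbb{R}^{2d})$. -/

import Mathlib

open MeasureTheory
open scoped ENNReal SchwartzMap ComplexConjugate

section TimeFrequency

variable {V : Type*} [NormedAddCommGroup V] [InnerProductSpace ℝ V]

/-- The unimodular character `y ↦ e^{-2πi y·ω}`. -/
noncomputable def freqChar (ω y : V) : ℂ :=
  Complex.exp (((-2 * Real.pi * inner ℝ y ω : ℝ) : ℂ) * Complex.I)

theorem hasTemperateGrowth_cexp_ofReal_mul_I :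
    Function.HasTemperateGrowth (fun t : ℝ => Complex.exp ((t : ℂ) * Complex.I)) := by
  have hd : ∀ n : ℕ, iteratedDeriv n (fun t : ℝ => Complex.exp ((t : ℂ) * Complex.I))
      = fun t : ℝ => Complex.I ^ n * Complex.exp ((t : ℂ) * Complex.I) := by
    intro n
    induction n with
    | zero => simp
    | succ k ih =>
      rw [iteratedDeriv_succ, ih]
      funext t
      have h1 : HasDerivAt (fun t : ℝ => (t : ℂ) * Complex.I) (1 * Complex.I) t :=
        (Complex.ofRealCLM.hasDerivAt (x := t)).mul_const Complex.I
      rw [(h1.cexp.const_mul (Complex.I ^ k)).deriv]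
      ring
  refine ⟨(Complex.ofRealCLM.contDiff.mul contDiff_const).cexp, fun n => ⟨0, 1, fun t => ?_⟩⟩
  rw [norm_iteratedFDeriv_eq_norm_iteratedDeriv, hd]
  simp [Complex.norm_exp_ofReal_mul_I]

theorem freqChar_hasTemperateGrowth (ω : V) :
    Function.HasTemperateGrowth (freqChar ω) := by
  have h : freqChar ω = (fun t : ℝ => Complex.exp ((t : ℂ) * Complex.I)) ∘
      (fun y : V => inner ℝ y ((-2 * Real.pi) • ω)) := by
    funext y
    simp only [freqChar, Function.comp, inner_smul_right]
  rw [h]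
  exact hasTemperateGrowth_cexp_ofReal_mul_I.comp
    (Function.hasTemperateGrowth_inner_left _)

/-- The Schwartz function `y ↦ conj (g (y - x)) * e^{-2πi y·ω}`, against which a tempered
distribution is tested in its short-time Fourier transform. -/
noncomputable def stftTest (g : 𝓢(V, ℂ)) (x ω : V) : 𝓢(V, ℂ) :=
  SchwartzMap.smulLeftCLM ℂ (freqChar ω)
    (SchwartzMap.postcompCLM (𝕜 := ℝ) (Complex.conjCLE : ℂ →L[ℝ] ℂ)
      (SchwartzMap.compSubConstCLM ℝ x g))

theorem stftTest_apply (g : 𝓢(V, ℂ)) (x ω y : V) :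
    stftTest g x ω y = conj (g (y - x)) * freqChar ω y := by
  simp [stftTest, freqChar_hasTemperateGrowth, mul_comm]

/-- The short-time Fourier transform `V_g f (x, ω)` of a tempered distribution `f` with respect to
the window `g`. -/
noncomputable def stft (g : 𝓢(V, ℂ)) (f : 𝓢'(V, ℂ)) (x ω : V) : ℂ :=
  f (stftTest g x ω)

variable [FiniteDimensional ℝ V] [MeasurableSpace V] [BorelSpace V]

/-- The norm of `f` in `W(ℱL^p, L^q)(V)`, measured with the window `g`: the `L^p` norm of
`V_g f (x, ω)` in the frequency `ω`, followed by the `L^q` norm in `x`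
(essential suprema for infinite exponents). Its value is `∞` when `f` is not in the space. -/
noncomputable def wienerAmalgamNorm (g : 𝓢(V, ℂ)) (p q : ℝ≥0∞) (f : 𝓢'(V, ℂ)) : ℝ≥0∞ :=
  eLpNorm (fun x : V => eLpNorm (fun ω : V => stft g f x ω) p volume) q volume

variable (V) in
/-- The Wiener amalgam space `W(ℱL^p, L^q)(V)`, `1 ≤ p, q ≤ ∞`: the tempered distributions whose
norm is finite for the nonzero Schwartz windows (which all give equivalent norms). -/
def wienerAmalgam (p q : ℝ≥0∞) : Set (𝓢'(V, ℂ)) :=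
  {f | ∀ g : 𝓢(V, ℂ), g ≠ 0 → wienerAmalgamNorm g p q f < ∞}

/-- The function `F` defines, by integration against Schwartz functions, the tempered
distribution `T`. -/
def RepresentsDistribution (F : V → ℂ) (T : 𝓢'(V, ℂ)) : Prop :=
  ∀ φ : 𝓢(V, ℂ), Integrable (fun z => F z * φ z) volume ∧ T φ = ∫ z, F z * φ z

/-- A function belongs to `W(ℱL^p, L^q)(V)` if it defines a tempered distribution which lies in
that space. -/
def MemWienerAmalgam (p q : ℝ≥0∞) (F : V → ℂ) : Prop :=
  ∃ T : 𝓢'(V, ℂ), RepresentsDistribution F T ∧ T ∈ wienerAmalgam V p q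

end TimeFrequency

/-- The phase space `ℝ^{2d} = ℝ^d × ℝ^d`, with its Euclidean structure. -/
abbrev PhaseSpace (d : ℕ) : Type :=
  WithLp 2 (EuclideanSpace ℝ (Fin d) × EuclideanSpace ℝ (Fin d))

/-- The normalized cardinal sine: `sin (π ξ) / (π ξ)` for `ξ ≠ 0`, and `1` at `ξ = 0`. -/
noncomputable def normSinc (ξ : ℝ) : ℝ :=
  if ξ = 0 then 1 else Real.sin (Real.pi * ξ) / (Real.pi * ξ)

/-- The `n`th Born-Jordan kernel `Θ^n (x, ω) = sinc^n (x·ω)` on `ℝ^{2d}`. -/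
noncomputable def bornJordanKernel (d n : ℕ) (z : PhaseSpace d) : ℂ :=
  ((normSinc (inner ℝ z.fst z.snd) ^ n : ℝ) : ℂ)

/-! ### Uniform decay of Fourier transforms -/

section UniformDecay

open scoped FourierTransform

/-! Since `sinc` is the Fourier transform of the indicator of a unit interval, `sinc^n (x·ω)` is a
superposition of chirps `e^{2πiτ x·ω}` against a finite measure carried by `|τ| ≤ n/2`
(`bornJordanKernel_eq_integral_chirp`). For one chirp, moving the window to `x` only shifts the
frequency by `τ` times the swap of `x` (`norm_integral_chirp_mul_stftTest`), so the `L¹` norm in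
frequency does not depend on `x`. It is bounded uniformly for bounded `τ`
(`exists_fourier_chirp_bound`), and Tonelli then integrates the bound over `τ`. -/

/-- Multiplying a Schwartz function by a family of functions that has temperate growth jointly with
its parameter gives Schwartz decay that is uniform for bounded parameters. -/
theorem exists_uniform_decay_mul_schwartz {E : Type*} [NormedAddCommGroup E] [NormedSpace ℝ E]
    {Φ : ℝ × E → ℂ} (hΦ : Φ.HasTemperateGrowth) (u : 𝓢(E, ℂ)) (R : ℝ) (M N : ℕ) :
    ∃ C : ℝ, ∀ τ : ℝ, |τ| ≤ R → ∀ j ≤ N, ∀ z : E,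
      (1 + ‖z‖) ^ M * ‖iteratedFDeriv ℝ j (fun z => Φ (τ, z) * u z) z‖ ≤ C := by
  obtain ⟨k, K, hK, hb⟩ := hΦ.norm_iteratedFDeriv_le_uniform N
  -- The extra weight `k` pays for the polynomial growth of the derivatives of `Φ`.
  set S : ℝ := 2 ^ (k + M) * ((Finset.Iic (k + M, N)).sup fun m => SchwartzMap.seminorm ℝ m.1 m.2) u
  refine ⟨2 ^ N * (K * (1 + R) ^ k * S), fun τ hτ j hj z => ?_⟩
  have hR : 0 ≤ R := (abs_nonneg τ).trans hτ
  have hslice : ∀ i ≤ N, ‖iteratedFDeriv ℝ i (fun z => Φ (τ, z)) z‖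
      ≤ K * (1 + R) ^ k * (1 + ‖z‖) ^ k := by
    intro i hi
    -- A slice is a translate of `Φ` composed with an injection of norm at most 1, so its
    -- derivatives inherit the joint bounds.
    have h1 : (fun z => Φ (τ, z))
        = (fun p => Φ ((τ, (0 : E)) + p)) ∘ (ContinuousLinearMap.inr ℝ ℝ E) := by
      funext z; simp
    have h2 : ContDiff ℝ i (fun p => Φ ((τ, (0 : E)) + p)) :=
      (hΦ.1.of_le (mod_cast le_top)).comp (contDiff_const.add contDiff_id)
    rw [h1, ContinuousLinearMap.iteratedFDeriv_comp_right _ h2 z le_rfl,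
      iteratedFDeriv_comp_add_left]
    refine (ContinuousMultilinearMap.norm_compContinuousLinearMap_le _ _).trans ?_
    have h3 : ∏ _x : Fin i, ‖ContinuousLinearMap.inr ℝ ℝ E‖ ≤ 1 :=
      Finset.prod_le_one (fun _ _ => norm_nonneg _)
        (fun _ _ => ContinuousLinearMap.norm_inr_le_one ℝ ℝ E)
    refine (mul_le_of_le_one_right (norm_nonneg _) h3).trans ((hb i hi _).trans ?_)
    rw [mul_assoc, ← mul_pow]
    gcongr
    have : ‖((τ, (0 : E)) + ContinuousLinearMap.inr ℝ ℝ E z)‖ ≤ R + ‖z‖ := by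
      simp only [ContinuousLinearMap.inr_apply, Prod.mk_add_mk, add_zero, zero_add]
      refine max_le ?_ ?_
      · exact (Real.norm_eq_abs τ ▸ hτ).trans (by simp)
      · simpa using hR
    nlinarith [norm_nonneg z]
  have hS : ∀ i ≤ N, (1 + ‖z‖) ^ (k + M) * ‖iteratedFDeriv ℝ i u z‖ ≤ S := fun i hi =>
    SchwartzMap.one_add_le_sup_seminorm_apply (𝕜 := ℝ) (m := (k + M, N)) le_rfl hi u z
  have hprod := norm_iteratedFDeriv_mul_le (N := j) (f := fun z => Φ (τ, z))
    ((hΦ.1.of_le (mod_cast le_top)).comp (contDiff_const.prodMk contDiff_id) :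
      ContDiff ℝ j (fun z : E => Φ (τ, z))) ((u.smooth j)) z le_rfl
  calc (1 + ‖z‖) ^ M * ‖iteratedFDeriv ℝ j (fun z => Φ (τ, z) * u z) z‖
      ≤ (1 + ‖z‖) ^ M * ∑ i ∈ Finset.range (j + 1), (j.choose i : ℝ) *
          ‖iteratedFDeriv ℝ i (fun z => Φ (τ, z)) z‖ * ‖iteratedFDeriv ℝ (j - i) u z‖ := by
        gcongr
    _ = ∑ i ∈ Finset.range (j + 1), (j.choose i : ℝ) * ((1 + ‖z‖) ^ M *
          ‖iteratedFDeriv ℝ i (fun z => Φ (τ, z)) z‖ * ‖iteratedFDeriv ℝ (j - i) u z‖) := by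
        rw [Finset.mul_sum]; exact Finset.sum_congr rfl fun i _ => by ring
    _ ≤ ∑ i ∈ Finset.range (j + 1), (j.choose i : ℝ) * (K * (1 + R) ^ k * S) := by
        refine Finset.sum_le_sum fun i hi => ?_
        have hi' : i ≤ N := by have := Finset.mem_range.1 hi; omega
        refine mul_le_mul_of_nonneg_left ?_ (Nat.cast_nonneg _)
        calc _ ≤ (1 + ‖z‖) ^ M * (K * (1 + R) ^ k * (1 + ‖z‖) ^ k) *
              ‖iteratedFDeriv ℝ (j - i) u z‖ := by gcongr; exact hslice i hi'
          _ = K * (1 + R) ^ k * ((1 + ‖z‖) ^ (k + M) * ‖iteratedFDeriv ℝ (j - i) u z‖) := by ring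
          _ ≤ _ := by gcongr; exact hS _ (by omega)
    _ = 2 ^ j * (K * (1 + R) ^ k * S) := by
        rw [← Finset.sum_mul]; congr 1; exact_mod_cast Nat.sum_range_choose j
    _ ≤ _ := by
        have : 0 ≤ S := (by positivity : (0:ℝ) ≤ _).trans (hS 0 (Nat.zero_le _))
        gcongr
        norm_num

variable {V : Type*} [NormedAddCommGroup V] [InnerProductSpace ℝ V] [FiniteDimensional ℝ V]
  [MeasurableSpace V] [BorelSpace V]

/-- Integrable decay of the first `M` derivatives gives decay of order `M` of the Fourier transform,
with a constant that depends only on the decay. -/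
theorem exists_fourier_decay_bound {M : ℕ} (hM : Module.finrank ℝ V < M) (C : ℝ) :
    ∃ A : ℝ, ∀ f : V → ℂ, ContDiff ℝ M f →
      (∀ j ≤ M, ∀ z, (1 + ‖z‖) ^ M * ‖iteratedFDeriv ℝ j f z‖ ≤ C) →
      ∀ w, ‖𝓕 f w‖ ≤ A * (1 + ‖w‖) ^ (-(M : ℝ)) := by
  have hint : Integrable (fun z : V => C * (1 + ‖z‖) ^ (-(M : ℝ))) :=
    (integrable_one_add_norm (by exact_mod_cast hM)).const_mul C
  set B : ℝ := ∫ z : V, C * (1 + ‖z‖) ^ (-(M : ℝ))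
  -- `B` bounds `𝓕 f`, the second summand bounds `‖w‖ ^ M * ‖𝓕 f w‖`, and the outer `2 ^ M` comes
  -- from `(1 + r) ^ M ≤ 2 ^ M * (1 + r ^ M)`.
  refine ⟨2 ^ M * (B + 2 ^ M * ((M + 1) * B)), fun f hf hdec w => ?_⟩
  have hle : ∀ j ≤ M, ∀ z, ‖iteratedFDeriv ℝ j f z‖ ≤ C * (1 + ‖z‖) ^ (-(M : ℝ)) := by
    intro j hj z
    rw [Real.rpow_neg (by positivity), Real.rpow_natCast, ← div_eq_mul_inv, le_div_iff₀ (by positivity),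
      mul_comm]
    exact hdec j hj z
  have hi : ∀ j ≤ M, Integrable (fun z => ‖iteratedFDeriv ℝ j f z‖) := fun j hj =>
    hint.mono' ((hf.continuous_iteratedFDeriv (mod_cast hj)).norm.aestronglyMeasurable)
      (ae_of_all _ fun z => by simpa using hle j hj z)
  have hB : ∀ j ≤ M, ∫ z, ‖iteratedFDeriv ℝ j f z‖ ≤ B := fun j hj =>
    integral_mono (hi j hj) hint (hle j hj)
  have key : ∀ n ≤ M, ‖w‖ ^ n * ‖𝓕 f w‖ ≤ 2 ^ n * ∑ j ∈ Finset.range (n + 1), B := by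
    intro n hn
    have := Real.pow_mul_norm_iteratedFDeriv_fourier_le (K := 0) (N := M) (f := f)
      (mod_cast hf) (fun k n hk hn => by
        obtain rfl : k = 0 := by simpa using hk
        simpa using hi n (by exact_mod_cast hn)) (k := 0) (n := n) le_rfl (mod_cast hn) w
    simp only [norm_iteratedFDeriv_zero, pow_zero, one_mul, Nat.cast_zero, mul_zero, zero_add,
      Finset.range_one, Finset.sum_product, Finset.sum_singleton] at this
    refine this.trans ?_
    gcongr with j hj
    exact hB j (by have := Finset.mem_range.1 hj; omega)
  have h0 : ‖𝓕 f w‖ ≤ B := by simpa using key 0 (Nat.zero_le _)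
  have h1 : ‖w‖ ^ M * ‖𝓕 f w‖ ≤ 2 ^ M * ((M + 1) * B) := by simpa using key M le_rfl
  rw [Real.rpow_neg (by positivity), Real.rpow_natCast, ← div_eq_mul_inv, le_div_iff₀ (by positivity)]
  have h2 : (1 + ‖w‖) ^ M ≤ 2 ^ M * (1 + ‖w‖ ^ M) := by
    rcases le_total ‖w‖ 1 with h | h
    · calc (1 + ‖w‖) ^ M ≤ 2 ^ M := by gcongr; linarith
        _ ≤ _ := le_mul_of_one_le_right (by positivity) (by simp)
    · calc (1 + ‖w‖) ^ M ≤ (2 * ‖w‖) ^ M := by gcongr; linarith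
        _ = 2 ^ M * ‖w‖ ^ M := mul_pow _ _ _
        _ ≤ _ := by gcongr; simp
  calc ‖𝓕 f w‖ * (1 + ‖w‖) ^ M ≤ ‖𝓕 f w‖ * (2 ^ M * (1 + ‖w‖ ^ M)) := by gcongr
    _ = 2 ^ M * (‖𝓕 f w‖ + ‖w‖ ^ M * ‖𝓕 f w‖) := by ring
    _ ≤ _ := by gcongr

end UniformDecay

/-! ### Chirps and their superpositions -/

section Chirp

open scoped FourierTransform

variable {d : ℕ}

/-- The chirp `e^{2πi τ x·ω}` on phase space. -/
noncomputable def chirp (τ : ℝ) (z : PhaseSpace d) : ℂ :=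
  Complex.exp (((2 * Real.pi * τ * inner ℝ z.fst z.snd : ℝ) : ℂ) * Complex.I)

theorem norm_chirp (τ : ℝ) (z : PhaseSpace d) : ‖chirp τ z‖ = 1 :=
  Complex.norm_exp_ofReal_mul_I _

theorem continuous_chirp_uncurry :
    Continuous (fun p : ℝ × PhaseSpace d => chirp p.1 p.2) := by
  unfold chirp
  have h1 : Continuous fun p : ℝ × PhaseSpace d => p.2.fst :=
    (WithLp.fstL 2 ℝ _ _).continuous.comp continuous_snd
  have h2 : Continuous fun p : ℝ × PhaseSpace d => p.2.snd :=
    (WithLp.sndL 2 ℝ _ _).continuous.comp continuous_snd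
  have h3 := h1.inner (𝕜 := ℝ) h2
  fun_prop

/-- Treating `τ` as a variable is what later yields constants uniform in `τ`. -/
theorem hasTemperateGrowth_chirp_uncurry :
    Function.HasTemperateGrowth (fun p : ℝ × PhaseSpace d => chirp p.1 p.2) := by
  have h1 : Function.HasTemperateGrowth fun p : ℝ × PhaseSpace d => p.2.fst :=
    ((WithLp.fstL 2 ℝ (EuclideanSpace ℝ (Fin d)) (EuclideanSpace ℝ (Fin d))).comp
      (ContinuousLinearMap.snd ℝ ℝ (PhaseSpace d))).hasTemperateGrowth
  have h2 : Function.HasTemperateGrowth fun p : ℝ × PhaseSpace d => p.2.snd :=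
    ((WithLp.sndL 2 ℝ (EuclideanSpace ℝ (Fin d)) (EuclideanSpace ℝ (Fin d))).comp
      (ContinuousLinearMap.snd ℝ ℝ (PhaseSpace d))).hasTemperateGrowth
  have h3 : Function.HasTemperateGrowth fun p : ℝ × PhaseSpace d => p.1 :=
    (ContinuousLinearMap.fst ℝ ℝ (PhaseSpace d)).hasTemperateGrowth
  have h4 := (innerSL ℝ (E := EuclideanSpace ℝ (Fin d))).bilinear_hasTemperateGrowth h1 h2
  have h5 := ((Function.HasTemperateGrowth.const (2 * Real.pi)).mul h3).mul h4
  exact hasTemperateGrowth_cexp_ofReal_mul_I.comp h5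

theorem chirp_sum {ι : Type*} (s : Finset ι) (τ : ι → ℝ) (z : PhaseSpace d) :
    chirp (∑ i ∈ s, τ i) z = ∏ i ∈ s, chirp (τ i) z := by
  simp only [chirp, ← Complex.exp_sum]
  push_cast
  rw [Finset.mul_sum, Finset.sum_mul, Finset.sum_mul]

/-- Interchange of the two components of phase space. -/
def phaseSwap (x : PhaseSpace d) : PhaseSpace d := WithLp.toLp 2 (x.snd, x.fst)

/-- The phase `x·ω` is quadratic: the cross terms of its expansion at `y + x` are linear in `y` and
merge into the character. -/
theorem chirp_add_mul_freqChar (τ : ℝ) (x ω y : PhaseSpace d) :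
    chirp τ (y + x) * freqChar ω (y + x)
      = (chirp τ x * freqChar ω x) * (chirp τ y * freqChar (ω - τ • phaseSwap x) y) := by
  simp only [chirp, freqChar, ← Complex.exp_add, ← add_mul, ← Complex.ofReal_add]
  congr 3
  simp only [WithLp.prod_inner_apply, phaseSwap, WithLp.fst, WithLp.snd, WithLp.ofLp_add,
    Prod.fst_add, Prod.snd_add, inner_add_left, inner_add_right, inner_sub_right,
    inner_smul_right]
  rw [real_inner_comm x.ofLp.1 y.ofLp.2]
  ring

theorem norm_freqChar (ω y : PhaseSpace d) : ‖freqChar ω y‖ = 1 :=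
  Complex.norm_exp_ofReal_mul_I _

/-- Up to a unimodular factor, the short-time Fourier transform of a chirp is a translate in
frequency of the Fourier transform of the chirped window. -/
theorem norm_integral_chirp_mul_stftTest (g : 𝓢(PhaseSpace d, ℂ)) (τ : ℝ) (x ω : PhaseSpace d) :
    ‖∫ y, chirp τ y * stftTest g x ω y‖
      = ‖𝓕 (fun y => chirp τ y * conj (g y)) (ω - τ • phaseSwap x)‖ := by
  rw [← integral_add_right_eq_self _ x, Real.fourier_eq']
  have : ∀ y, chirp τ (y + x) * stftTest g x ω (y + x) = (chirp τ x * freqChar ω x) *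
      (Complex.exp (((-2 * Real.pi * inner ℝ y (ω - τ • phaseSwap x) : ℝ) : ℂ) * Complex.I) •
        (chirp τ y * conj (g y))) := by
    intro y
    have h := chirp_add_mul_freqChar τ x ω y
    rw [stftTest_apply, add_sub_cancel_right, mul_left_comm, h, freqChar, freqChar, smul_eq_mul]
    ring
  simp_rw [this]
  rw [integral_const_mul, norm_mul, norm_mul, norm_chirp, norm_freqChar, one_mul, one_mul]

theorem exists_fourier_chirp_bound (g : 𝓢(PhaseSpace d, ℂ)) (R : ℝ) {M : ℕ}
    (hM : Module.finrank ℝ (PhaseSpace d) < M) :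
    ∃ A : ℝ, ∀ τ : ℝ, |τ| ≤ R → ∀ w : PhaseSpace d,
      ‖𝓕 (fun y => chirp τ y * conj (g y)) w‖ ≤ A * (1 + ‖w‖) ^ (-(M : ℝ)) := by
  let u : 𝓢(PhaseSpace d, ℂ) :=
    SchwartzMap.postcompCLM (𝕜 := ℝ) (Complex.conjCLE : ℂ →L[ℝ] ℂ) g
  have hu : ∀ y, u y = conj (g y) := fun y => by simp [u]
  simp_rw [← hu]
  obtain ⟨C, hC⟩ := exists_uniform_decay_mul_schwartz hasTemperateGrowth_chirp_uncurry u R M M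
  obtain ⟨A, hA⟩ := exists_fourier_decay_bound hM C
  refine ⟨A, fun τ hτ => hA _ ?_ (hC τ hτ)⟩
  have h1 : ContDiff ℝ M (fun z : PhaseSpace d => chirp τ z) :=
    ((hasTemperateGrowth_chirp_uncurry (d := d)).1.of_le (mod_cast le_top)).comp
      (contDiff_const.prodMk contDiff_id : ContDiff ℝ M (fun z : PhaseSpace d => (τ, z)))
  exact h1.mul (u.smooth M)

theorem stronglyMeasurable_integral_chirp (μ : Measure ℝ) [SFinite μ] :
    StronglyMeasurable (fun z : PhaseSpace d => ∫ τ, chirp τ z ∂μ) :=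
  (continuous_chirp_uncurry.comp continuous_swap).stronglyMeasurable.integral_prod_right'

theorem norm_integral_chirp_le (μ : Measure ℝ) [IsFiniteMeasure μ] (z : PhaseSpace d) :
    ‖∫ τ, chirp τ z ∂μ‖ ≤ μ.real Set.univ := by
  simpa using norm_integral_le_of_norm_le_const (μ := μ)
    (ae_of_all _ fun τ => (norm_chirp τ z).le)

theorem representsDistribution_of_bounded {F : PhaseSpace d → ℂ} (hF : StronglyMeasurable F)
    {B : ℝ} (hB : ∀ z, ‖F z‖ ≤ B) : ∃ T, RepresentsDistribution F T := by
  have hmem : MemLp F ∞ (volume : Measure (PhaseSpace d)) :=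
    memLp_top_of_bound hF.aestronglyMeasurable B (ae_of_all _ hB)
  refine ⟨Lp.toTemperedDistribution (hmem.toLp F), fun φ => ⟨?_, ?_⟩⟩
  · exact φ.integrable.bdd_mul hF.aestronglyMeasurable (ae_of_all _ hB)
  · rw [Lp.toTemperedDistribution_apply]
    refine integral_congr_ae ?_
    filter_upwards [hmem.coeFn_toLp] with z hz
    rw [hz, smul_eq_mul, mul_comm]

theorem memWienerAmalgam_integral_chirp (μ : Measure ℝ) [IsFiniteMeasure μ] {R : ℝ}
    (hR : ∀ᵐ τ ∂μ, |τ| ≤ R) :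
    MemWienerAmalgam 1 ∞ (fun z : PhaseSpace d => ∫ τ, chirp τ z ∂μ) := by
  obtain ⟨T, hT⟩ := representsDistribution_of_bounded (d := d)
    (stronglyMeasurable_integral_chirp μ) (norm_integral_chirp_le μ)
  refine ⟨T, hT, fun g _ => ?_⟩
  -- The least integer for which `(1 + ‖w‖) ^ (-M)` is integrable.
  set M : ℕ := Module.finrank ℝ (PhaseSpace d) + 1 with hM
  obtain ⟨A, hA⟩ := exists_fourier_chirp_bound g R (M := M) (by omega)
  set D : ℝ≥0∞ := ∫⁻ w : PhaseSpace d, ENNReal.ofReal (A * (1 + ‖w‖) ^ (-(M : ℝ))) with hD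
  have hDfin : D < ∞ :=
    ((integrable_one_add_norm (by rw [hM]; push_cast; linarith)).const_mul A).lintegral_lt_top
  have hstft : ∀ x ω, stft g T x ω = ∫ τ, ∫ y, chirp τ y * stftTest g x ω y ∂volume ∂μ := by
    intro x ω
    rw [stft, (hT _).2]
    simp_rw [← integral_mul_const]
    refine integral_integral_swap (f := fun y τ => chirp τ y * stftTest g x ω y) ?_
    refine Integrable.bdd_mul (c := 1) ((stftTest g x ω).integrable.comp_fst μ)
      (continuous_chirp_uncurry.comp continuous_swap).aestronglyMeasurable ?_
    exact ae_of_all _ fun p => (norm_chirp p.2 p.1).le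
  have hpt : ∀ x ω, ‖stft g T x ω‖ₑ
      ≤ ∫⁻ τ, ENNReal.ofReal (A * (1 + ‖ω - τ • phaseSwap x‖) ^ (-(M : ℝ))) ∂μ := by
    intro x ω
    rw [hstft]
    refine (enorm_integral_le_lintegral_enorm _).trans (lintegral_mono_ae ?_)
    filter_upwards [hR] with τ hτ
    rw [← ofReal_norm, norm_integral_chirp_mul_stftTest]
    exact ENNReal.ofReal_le_ofReal (hA τ hτ _)
  have hnorm : ∀ x, eLpNorm (fun ω => stft g T x ω) 1 volume ≤ D * μ Set.univ := by
    intro x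
    rw [eLpNorm_one_eq_lintegral_enorm]
    refine (lintegral_mono (hpt x)).trans ?_
    rw [lintegral_lintegral_swap (by fun_prop)]
    -- Translation invariance removes both `x` and `τ`.
    have (τ : ℝ) : ∫⁻ ω, ENNReal.ofReal (A * (1 + ‖ω - τ • phaseSwap x‖) ^ (-(M : ℝ))) = D :=
      lintegral_sub_right_eq_self
        (fun w => ENNReal.ofReal (A * (1 + ‖w‖) ^ (-(M : ℝ)))) (τ • phaseSwap x)
    simp_rw [this, lintegral_const, le_refl]
  rw [wienerAmalgamNorm, eLpNorm_exponent_top]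
  exact (eLpNormEssSup_le_of_ae_enorm_bound (ae_of_all _ hnorm)).trans_lt
    (ENNReal.mul_lt_top hDfin (measure_lt_top μ _))

end Chirp

/-! ### The kernel as a superposition of chirps -/

section Sinc

theorem integral_exp_two_pi_eq_normSinc (t : ℝ) :
    ∫ τ in Set.Ioc (-(1 / 2 : ℝ)) (1 / 2), Complex.exp (((2 * Real.pi * τ * t : ℝ) : ℂ) * Complex.I)
      = normSinc t := by
  rw [← intervalIntegral.integral_of_le (by norm_num)]
  rcases eq_or_ne t 0 with rfl | ht
  · simp [normSinc]; norm_num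
  · have hπt : 2 * Real.pi * t ≠ 0 := by positivity
    have h := intervalIntegral.integral_comp_mul_left (a := -(1 / 2 : ℝ)) (b := 1 / 2)
      (fun s : ℝ => Complex.exp ((s : ℂ) * Complex.I)) hπt
    have e1 : 2 * Real.pi * t * -(1 / 2) = -(Real.pi * t) := by ring
    have e2 : 2 * Real.pi * t * (1 / 2) = Real.pi * t := by ring
    rw [e1, e2, integral_exp_mul_I_eq_sinc] at h
    have e3 : ∀ τ : ℝ, 2 * Real.pi * τ * t = 2 * Real.pi * t * τ := fun τ => by ring
    simp_rw [e3, h]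
    rw [normSinc, if_neg ht, Real.sinc_of_ne_zero (by positivity), Complex.real_smul,
      ← Complex.ofReal_ofNat, ← Complex.ofReal_mul, ← Complex.ofReal_mul, ← Complex.ofReal_mul]
    congr 1
    field_simp

/-- The pushforward under the sum is an `n`-fold convolution power; chirps turn sums of parameters
into products, so the integral factors into `n` copies of `sinc`. -/
theorem bornJordanKernel_eq_integral_chirp (d n : ℕ) (z : PhaseSpace d) :
    bornJordanKernel d n z = ∫ τ, chirp τ z ∂((Measure.pi fun _ : Fin n =>
      volume.restrict (Set.Ioc (-(1 / 2 : ℝ)) (1 / 2))).map fun τ => ∑ i, τ i) := by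
  have hc : Continuous fun τ : ℝ => chirp τ z :=
    continuous_chirp_uncurry.comp (by fun_prop : Continuous fun τ : ℝ => (τ, z))
  rw [integral_map (by fun_prop) hc.aestronglyMeasurable]
  simp_rw [chirp_sum]
  rw [integral_fintype_prod_eq_pow (fun τ : ℝ => chirp τ z)]
  simp only [chirp]
  rw [integral_exp_two_pi_eq_normSinc, Fintype.card_fin, bornJordanKernel, Complex.ofReal_pow]

end Sinc

theorem proposition3 (d n : ℕ) (hn : 1 ≤ n) :
    MemWienerAmalgam 1 ∞ (bornJordanKernel d n) := by
  rw [funext (bornJordanKernel_eq_integral_chirp d n)]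
  -- A sum of `n` numbers, each at most `1/2` in modulus.
  refine memWienerAmalgam_integral_chirp _ (R := n * (1 / 2)) ?_
  rw [ae_map_iff (by fun_prop) (measurableSet_le (by fun_prop) (by fun_prop)),
    ← Measure.restrict_pi_pi]
  refine (ae_restrict_iff' (MeasurableSet.univ_pi fun _ => measurableSet_Ioc)).2
    (ae_of_all _ fun τ hτ => ?_)
  refine (Finset.abs_sum_le_sum_abs _ _).trans
    ((Finset.sum_le_card_nsmul _ _ (1 / 2) fun i _ => ?_).trans_eq (by simp))
  have := hτ i (Set.mem_univ i)
  exact abs_le.2 ⟨this.1.le, this.2⟩
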